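/- For $0\le\rho\le1$, a pair of $\rho$-correlated bits is a pair $(a,b)$ of $\{+1,-1\}$-valued random variables with $\mathbb E[a]=\mathbb E[b]=0$ and $\mathbb E[ab]=\rho$. In a one-way protocol with $\rho$-correlated randomness, Alice holds $x$ and $r=(r_1,\dots,r_N)$, Bob holds $y$ and $r'=(r'_1,\dots,r'_N)$, where the pairs $(r_i,r'_i)$ are independent pairs of $\rho$-correlated bits and the protocol may choose $N$ arbitrarily large. Alice sends a single binary message, determined by $(x,r)$ and taken from a prefix-free set of strings, and Bob outputs a bit determined by $y$, $r'$ and the message. The protocol solves a promise problem if, for every yes-instance and every no-instance $(x,y)$, Bob's output is correct with probability at least $2/3$. Its cost is the maximum over all inputs of the expected number of bits sent. The one-way communication complexity $\mathrm{owisrCC}_\rho(P)$ of a promise problem $P$ is the infimum of the costs of the protocols that solve $P$. For $n\ge1$ and $0\le s<c\le1$, the problem $\mathrm{GapInnerProduct}^n_{c,s}$ has inputs $x,y\in\{0,1\}^n$; $(x,y)$ is a yes-instance if $\langle x,y\rangle\ge cn$ and a no-instance if $\langle x,y\rangle<sn$. Lemma. There is a universal constant $K>0$ such that for all integers $n\ge1$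 and all reals $0\le s<c\le1$ and $0<\rho\le1$, $$\mathrm{owisrCC}_\rho\bigl(\mathrm{GapInnerProduct}^n_{c,s}\bigr)\le\frac{K}{\rho^2(c-s)^2}.$$ -/

import Mathlib

open scoped ENNReal

noncomputable section

namespace ISR

/-- A promise problem on the input sets `X` (Alice) and `Y` (Bob): disjoint sets of yes-instances
and no-instances; nothing is required on the other inputs. -/
structure PromiseProblem (X Y : Type) where
  yes : Set (X × Y)
  no : Set (X × Y)
  disjoint : Disjoint yes no

/-- The probability that a pair of `ρ`-correlated uniform random bits, with values in `{+1, -1}`,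
takes the value `(a, b)`. -/
def pairProb (ρ : ℝ) (a b : ℤˣ) : ℝ :=
  (1 + ρ * ((a : ℤ) : ℝ) * ((b : ℤ) : ℝ)) / 4

lemma sum_units {f : ℤˣ → ℝ} : ∑ a : ℤˣ, f a = f 1 + f (-1) := by
  have h : (Finset.univ : Finset ℤˣ) = {1, -1} := by decide
  rw [h, Finset.sum_pair (by decide)]

lemma pairProb_nonneg {ρ : ℝ} (h0 : 0 ≤ ρ) (h1 : ρ ≤ 1) (a b : ℤˣ) : 0 ≤ pairProb ρ a b := by
  unfold pairProb
  rcases Int.units_eq_one_or a with rfl | rfl <;> rcases Int.units_eq_one_or b with rfl | rfl <;>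
    push_cast <;> linarith

lemma pairProb_sum (ρ : ℝ) : ∑ a : ℤˣ, ∑ b : ℤˣ, pairProb ρ a b = 1 := by
  simp only [sum_units, pairProb]; push_cast; ring

lemma pairProb_mean_left (ρ : ℝ) :
    ∑ a : ℤˣ, ∑ b : ℤˣ, pairProb ρ a b * ((a : ℤ) : ℝ) = 0 := by
  simp only [sum_units, pairProb]; push_cast; ring

lemma pairProb_mean_right (ρ : ℝ) :
    ∑ a : ℤˣ, ∑ b : ℤˣ, pairProb ρ a b * ((b : ℤ) : ℝ) = 0 := by
  simp only [sum_units, pairProb]; push_cast; ring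

lemma pairProb_correlation (ρ : ℝ) :
    ∑ a : ℤˣ, ∑ b : ℤˣ, pairProb ρ a b * (((a : ℤ) : ℝ) * ((b : ℤ) : ℝ)) = ρ := by
  simp only [sum_units, pairProb]; push_cast; ring

/-- The probability of `(r, r')` when the coordinate pairs `(r i, r' i)`, `i < N`, are independent
pairs of `ρ`-correlated uniform random bits. -/
def seqProb (ρ : ℝ) {N : ℕ} (r r' : Fin N → ℤˣ) : ℝ :=
  ∏ i, pairProb ρ (r i) (r' i)

lemma seqProb_sum (ρ : ℝ) (N : ℕ) :
    ∑ r : Fin N → ℤˣ, ∑ r' : Fin N → ℤˣ, seqProb ρ r r' = 1 := by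
  unfold seqProb
  have h : ∀ r : Fin N → ℤˣ, ∑ r' : Fin N → ℤˣ, ∏ i, pairProb ρ (r i) (r' i)
      = ∏ i, ∑ b, pairProb ρ (r i) b := by
    intro r
    rw [Finset.prod_univ_sum, Fintype.piFinset_univ]
  simp_rw [h]
  have h2 := Finset.prod_univ_sum (fun _ : Fin N => (Finset.univ : Finset ℤˣ))
    (fun _ a => ∑ b, pairProb ρ a b)
  rw [Fintype.piFinset_univ] at h2
  rw [← h2, pairProb_sum, Finset.prod_const_one]

/-- The expectation of `f r r'` when `(r, r')` is a sequence of `N` independent pairs of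
`ρ`-correlated uniform random bits. -/
def expectation (ρ : ℝ) {N : ℕ} (f : (Fin N → ℤˣ) → (Fin N → ℤˣ) → ℝ) : ℝ :=
  ∑ r, ∑ r', seqProb ρ r r' * f r r'

/-- A one-way protocol with access to correlated random bits. Alice sees the `N` bits `r` and Bob
the `N` bits `r'`, where `N` is chosen by the protocol and may be arbitrarily large. Alice sends
one binary message, which is a function of her input and of `r`; Bob's output is a function of his
input, of `r'` and of the message. As in every protocol tree, no possible message is a proper
prefix of another one, so that Bob knows when the message ends. -/
structure OneWayProtocol (X Y : Type) where
  N : ℕ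
  message : X → (Fin N → ℤˣ) → List Bool
  output : Y → (Fin N → ℤˣ) → List Bool → Bool
  prefix_free : ∀ x r x₁ r₁, message x r <+: message x₁ r₁ → message x r = message x₁ r₁

namespace OneWayProtocol

variable {X Y : Type}

/-- The probability that on input `(x, y)` Bob outputs `w`. -/
def outputProb (Q : OneWayProtocol X Y) (ρ : ℝ) (x : X) (y : Y) (w : Bool) : ℝ :=
  expectation ρ fun r r' => if Q.output y r' (Q.message x r) = w then 1 else 0

/-- The protocol solves the promise problem: Bob's output is correct with probability at least
`2/3` on each yes-instance and on each no-instance. -/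
def Solves (Q : OneWayProtocol X Y) (ρ : ℝ) (P : PromiseProblem X Y) : Prop :=
  (∀ x y, (x, y) ∈ P.yes → 2 / 3 ≤ Q.outputProb ρ x y true) ∧
  (∀ x y, (x, y) ∈ P.no → 2 / 3 ≤ Q.outputProb ρ x y false)

/-- The complexity of the protocol: the maximum over all inputs (also those that violate the
promise) of the expected number of bits sent. Bob's input does not influence this number. -/
def cost (Q : OneWayProtocol X Y) (ρ : ℝ) : ℝ≥0∞ :=
  ⨆ x : X, ENNReal.ofReal (expectation ρ fun r _ => ((Q.message x r).length : ℝ))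

end OneWayProtocol

/-- The one-way communication complexity of `P` with access to `ρ`-correlated random bits
(`∞` if no protocol solves `P`). -/
def owIsrCC {X Y : Type} (ρ : ℝ) (P : PromiseProblem X Y) : ℝ≥0∞ :=
  ⨅ (Q : OneWayProtocol X Y) (_ : Q.Solves ρ P), Q.cost ρ

/-- The inner product of two vectors in `{0,1}^n`. -/
def innerProd {n : ℕ} (x y : Fin n → Bool) : ℕ :=
  ∑ i, (x i).toNat * (y i).toNat

/-- The gap inner product problem in dimension `n` with completeness `c` and soundness `s`:
`(x, y)` is a yes-instance if `⟨x, y⟩ ≥ c n` and a no-instance if `⟨x, y⟩ < s n`. -/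
def gapInnerProduct (n : ℕ) (c s : ℝ) (hsc : s < c) :
    PromiseProblem (Fin n → Bool) (Fin n → Bool) where
  yes := {p | c * n ≤ (innerProd p.1 p.2 : ℝ)}
  no := {p | (innerProd p.1 p.2 : ℝ) < s * n}
  disjoint := by
    rw [Set.disjoint_left]
    intro p hy hn
    have h : s * (n : ℝ) ≤ c * n := mul_le_mul_of_nonneg_right hsc.le n.cast_nonneg
    have hy' : c * (n : ℝ) ≤ (innerProd p.1 p.2 : ℝ) := hy
    have hn' : (innerProd p.1 p.2 : ℝ) < s * (n : ℝ) := hn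
    linarith

end ISR

end

/-!
Write `ε = c - s`. The protocol uses `k = ⌈9 / (ρ² ε²)⌉` disjoint blocks of `n` pairs of correlated
bits and a message of exactly `k` bits, one per block. With `a j = 1` if `x j = 1` and `a j = -1`
otherwise, Alice's bit for a block `r` is the sign `σ` of the random walk `∑ j, a j * r j`. Bob
forms `T = ∑ j, y j * r' j`.

By the symmetries of the uniform distribution, `E[σ * r j] = α * a j`, where `α = E|S| / n` and
`S` is a sum of `n` independent uniform signs (`sum_sgn_walk_mul`). Passing from `r` to `r'`
costs a factor `ρ`, so `E[σ * T] = ρ α (2 ⟨x, y⟩ - |y|)` (`sum_seqProb_mul_blockStat`), and as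
Bob knows `|y|`, the mean tells him `⟨x, y⟩`. The second moment of `σ * T` is that of `T`, at most
`n`. The Khintchine-type bound `α² ≥ 1 / (3 n)` (`one_le_meanSign_sq`) follows from the second and
fourth moments of `S`.

Summed over the `k` independent blocks, the means for yes-instances and no-instances differ by at
least `2 k ρ α ε n`, while the variance is at most `k n`. Chebyshev's inequality for the threshold
halfway between bounds the error probability by `k n / (k ρ α ε n)² ≤ 3 / (k ρ² ε²) ≤ 1 / 3`.
-/

open scoped ENNReal

noncomputable section

namespace ISR

/-! ### Second moments under product weights -/

lemma sum_pi_prod {κ Ω : Type*} [Fintype κ] [DecidableEq κ] [Fintype Ω] (h : κ → Ω → ℝ) :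
    ∑ ω : κ → Ω, ∏ t, h t (ω t) = ∏ t, ∑ b, h t b := by
  rw [Finset.prod_univ_sum, Fintype.piFinset_univ]

lemma sum_pi_prod_mul {κ Ω : Type*} [Fintype κ] [DecidableEq κ] [Fintype Ω] {w : κ → Ω → ℝ}
    (g : Ω → ℝ) (t : κ) :
    ∑ ω : κ → Ω, (∏ v, w v (ω v)) * g (ω t)
      = (∑ b, w t b * g b) * ∏ v ∈ Finset.univ.erase t, ∑ b, w v b := by
  have h : ∀ ω : κ → Ω, (∏ v, w v (ω v)) * g (ω t)
      = ∏ v, w v (ω v) * (if v = t then g (ω v) else 1) := by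
    intro ω
    rw [Finset.prod_mul_distrib, Finset.prod_ite_eq' Finset.univ t, if_pos (Finset.mem_univ t)]
  simp_rw [h]
  rw [sum_pi_prod (fun v b => w v b * (if v = t then g b else 1)),
    ← Finset.mul_prod_erase Finset.univ _ (Finset.mem_univ t)]
  congr 1
  · simp
  · refine Finset.prod_congr rfl fun v hv => ?_
    simp [Finset.ne_of_mem_erase hv]

/-- The variance of a sum of independent centred random variables is the sum of their variances. -/
lemma sum_prod_mul_sq_sum {κ Ω : Type*} [Fintype κ] [DecidableEq κ] [Fintype Ω] {w : Ω → ℝ}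
    (hw : ∑ b, w b = 1) (g : κ → Ω → ℝ) (hg : ∀ t, ∑ b, w b * g t b = 0) :
    ∑ ω : κ → Ω, (∏ t, w (ω t)) * (∑ t, g t (ω t)) ^ 2 = ∑ t, ∑ b, w b * g t b ^ 2 := by
  have key : ∀ t u, ∑ ω : κ → Ω, (∏ v, w (ω v)) * (g t (ω t) * g u (ω u))
      = if t = u then ∑ b, w b * g t b ^ 2 else 0 := by
    intro t u
    split_ifs with htu
    · subst htu
      rw [sum_pi_prod_mul (w := fun _ => w) (fun b => g t b * g t b) t]
      simp [hw, sq]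
    · have h : ∀ ω : κ → Ω, (∏ v, w (ω v)) * (g t (ω t) * g u (ω u))
          = (∏ v, w (ω v) * (if v = u then g u (ω v) else 1)) * g t (ω t) := by
        intro ω
        rw [Finset.prod_mul_distrib, Finset.prod_ite_eq' Finset.univ u,
          if_pos (Finset.mem_univ u)]
        ring
      simp_rw [h]
      rw [sum_pi_prod_mul (w := fun v b => w b * (if v = u then g u b else 1)) (g t) t]
      simp [htu, hg]
  simp_rw [sq (∑ t, g t _), Finset.sum_mul_sum, Finset.mul_sum]
  rw [Finset.sum_comm]
  refine Finset.sum_congr rfl fun t _ => ?_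
  rw [Finset.sum_comm]
  simp_rw [key]
  simp

/-! ### The simple random walk -/

/-- The end point of the random walk with the steps `r`. -/
def walk {n : ℕ} (r : Fin n → ℤˣ) : ℝ := ∑ j, ((r j : ℤ) : ℝ)

/-- The sign of a real number, with `sgn 0 = 1` so that it can be encoded by one bit. -/
def sgn (s : ℝ) : ℝ := if 0 ≤ s then 1 else -1

lemma sgn_mul_self (s : ℝ) : sgn s * s = |s| := by
  unfold sgn
  split_ifs with h
  · rw [abs_of_nonneg h, one_mul]
  · rw [abs_of_neg (not_le.mp h)]; ring

lemma sgn_sq (s : ℝ) : sgn s ^ 2 = 1 := by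
  unfold sgn; split_ifs <;> norm_num

lemma sum_fin_succ_units {n : ℕ} (f : (Fin (n + 1) → ℤˣ) → ℝ) :
    ∑ r, f r = ∑ r : Fin n → ℤˣ, (f (Fin.cons 1 r) + f (Fin.cons (-1) r)) := by
  rw [← (Fin.consEquiv fun _ : Fin (n + 1) => ℤˣ).sum_comp, Fintype.sum_prod_type,
    sum_units, ← Finset.sum_add_distrib]
  rfl

lemma walk_cons {n : ℕ} (u : ℤˣ) (r : Fin n → ℤˣ) :
    walk (Fin.cons u r : Fin (n + 1) → ℤˣ) = ((u : ℤ) : ℝ) + walk r := by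
  simp [walk, Fin.sum_univ_succ]

lemma sum_one_units (n : ℕ) : ∑ _r : Fin n → ℤˣ, (1 : ℝ) = 2 ^ n := by
  simp

lemma sum_walk_sq (n : ℕ) : ∑ r : Fin n → ℤˣ, walk r ^ 2 = n * 2 ^ n := by
  induction n with
  | zero => simp [walk]
  | succ n ih =>
    have h : ∀ r : Fin n → ℤˣ, walk (Fin.cons 1 r : Fin (n + 1) → ℤˣ) ^ 2
        + walk (Fin.cons (-1) r : Fin (n + 1) → ℤˣ) ^ 2 = 2 * walk r ^ 2 + 2 * 1 := by
      intro r; simp only [walk_cons]; push_cast; ring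
    rw [sum_fin_succ_units]
    simp_rw [h]
    rw [Finset.sum_add_distrib, ← Finset.mul_sum, ← Finset.mul_sum, ih, sum_one_units]
    push_cast; ring

lemma sum_walk_pow_four (n : ℕ) :
    ∑ r : Fin n → ℤˣ, walk r ^ 4 = (3 * n ^ 2 - 2 * n) * 2 ^ n := by
  induction n with
  | zero => simp [walk]
  | succ n ih =>
    have h : ∀ r : Fin n → ℤˣ, walk (Fin.cons 1 r : Fin (n + 1) → ℤˣ) ^ 4
        + walk (Fin.cons (-1) r : Fin (n + 1) → ℤˣ) ^ 4
        = 2 * walk r ^ 4 + 12 * walk r ^ 2 + 2 * 1 := by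
      intro r; simp only [walk_cons]; push_cast; ring
    rw [sum_fin_succ_units]
    simp_rw [h]
    rw [Finset.sum_add_distrib, Finset.sum_add_distrib, ← Finset.mul_sum, ← Finset.mul_sum,
      ← Finset.mul_sum, ih, sum_walk_sq, sum_one_units]
    push_cast; ring

/-- The correlation `E|S| / n` of a single step with the sign of a random walk `S` of length `n`. -/
def meanSign (n : ℕ) : ℝ := (∑ r : Fin n → ℤˣ, |walk r|) / (n * 2 ^ n)

lemma meanSign_nonneg (n : ℕ) : 0 ≤ meanSign n := by
  unfold meanSign; positivity

/-- The lower bound `E|S| ≥ √(n / 3)`, in terms of `meanSign n = E|S| / n`. -/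
lemma one_le_meanSign_sq {n : ℕ} (hn : 0 < n) : 1 ≤ 3 * n * meanSign n ^ 2 := by
  have hn' : (0 : ℝ) < n := by exact_mod_cast hn
  set a : ℝ := √(3 * n) with ha
  have ha0 : 0 < a := by positivity
  have ha2 : a ^ 2 = 3 * n := Real.sq_sqrt (by positivity)
  -- With `t = |s| / a ≥ 0` this is `t * (t - 1) ^ 2 * (t + 2) ≥ 0`; the scale `a = √(3 n)` is
  -- the one for which the moment bound below is best.
  have pt : ∀ s : ℝ, 3 * a ^ 2 * s ^ 2 - s ^ 4 ≤ 2 * a ^ 3 * |s| := by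
    intro s
    have h : 0 ≤ |s| * (|s| - a) ^ 2 * (|s| + 2 * a) := by positivity
    have h2 : |s| ^ 2 = s ^ 2 := sq_abs s
    have h4 : |s| ^ 4 = s ^ 4 := by rw [show |s| ^ 4 = (|s| ^ 2) ^ 2 by ring, h2]; ring
    nlinarith
  have hs : ∑ r : Fin n → ℤˣ, (3 * a ^ 2 * walk r ^ 2 - walk r ^ 4)
      ≤ ∑ r : Fin n → ℤˣ, 2 * a ^ 3 * |walk r| :=
    Finset.sum_le_sum fun r _ => pt _
  rw [Finset.sum_sub_distrib, ← Finset.mul_sum, ← Finset.mul_sum, sum_walk_sq,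
    sum_walk_pow_four] at hs
  have hA : ∑ r : Fin n → ℤˣ, |walk r| = meanSign n * n * 2 ^ n := by
    unfold meanSign; field_simp
  rw [hA] at hs
  have h2n : (0 : ℝ) < 2 ^ n := by positivity
  have h1 : (a ^ 2 * n * 2 ^ n) * 2 ≤ (a ^ 2 * n * 2 ^ n) * (2 * (a * meanSign n)) := by
    nlinarith [mul_pos hn' h2n]
  have h3 : 1 ≤ a * meanSign n := by
    have := le_of_mul_le_mul_left h1 (by positivity)
    linarith
  calc (1 : ℝ) ≤ (a * meanSign n) ^ 2 := one_le_pow₀ h3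
    _ = 3 * n * meanSign n ^ 2 := by rw [mul_pow, ha2]

lemma sum_sgn_walk_mul_apply {n : ℕ} (hn : 0 < n) (i : Fin n) :
    ∑ r : Fin n → ℤˣ, sgn (walk r) * ((r i : ℤ) : ℝ) = meanSign n * 2 ^ n := by
  have hn' : (0 : ℝ) < n := by exact_mod_cast hn
  -- All coordinates are equally correlated with the sign, since `walk` is symmetric.
  have hsym : ∀ j, ∑ r : Fin n → ℤˣ, sgn (walk r) * ((r j : ℤ) : ℝ)
      = ∑ r : Fin n → ℤˣ, sgn (walk r) * ((r i : ℤ) : ℝ) := by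
    intro j
    refine Fintype.sum_equiv ((Equiv.swap i j).arrowCongr (Equiv.refl ℤˣ)) _ _ fun r => ?_
    have hw : walk ((Equiv.swap i j).arrowCongr (Equiv.refl ℤˣ) r) = walk r :=
      (Equiv.swap i j).symm.sum_comp fun j => ((r j : ℤ) : ℝ)
    rw [hw]
    simp [Equiv.arrowCongr]
  have hsum : ∑ j, ∑ r : Fin n → ℤˣ, sgn (walk r) * ((r j : ℤ) : ℝ)
      = ∑ r : Fin n → ℤˣ, |walk r| := by
    rw [Finset.sum_comm]
    refine Finset.sum_congr rfl fun r _ => ?_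
    rw [← Finset.mul_sum, ← sgn_mul_self]
    rfl
  simp_rw [hsym] at hsum
  rw [Finset.sum_const, Finset.card_univ, Fintype.card_fin, nsmul_eq_mul] at hsum
  unfold meanSign
  rw [← hsum]
  field_simp

lemma sum_sgn_walk_mul {n : ℕ} (hn : 0 < n) (a : Fin n → ℤˣ) (i : Fin n) :
    ∑ r : Fin n → ℤˣ, sgn (walk (a * r)) * ((r i : ℤ) : ℝ)
      = ((a i : ℤ) : ℝ) * (meanSign n * 2 ^ n) := by
  rw [← sum_sgn_walk_mul_apply hn i, Finset.mul_sum]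
  refine Fintype.sum_equiv (Equiv.mulLeft a) _ _ fun r => ?_
  have h : ((a i : ℤ) : ℝ) * ((a i : ℤ) : ℝ) = 1 := by
    rcases Int.units_eq_one_or (a i) with h | h <;> simp [h]
  simp only [Equiv.coe_mulLeft, Pi.mul_apply]
  push_cast
  linear_combination (-(sgn (walk (a * r)) * ((r i : ℤ) : ℝ))) * h

/-! ### One block of correlated bits -/

lemma seqProb_nonneg {ρ : ℝ} (h0 : 0 ≤ ρ) (h1 : ρ ≤ 1) {n : ℕ} (r r' : Fin n → ℤˣ) :
    0 ≤ seqProb ρ r r' :=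
  Finset.prod_nonneg fun _ _ => pairProb_nonneg h0 h1 _ _

lemma sum_seqProb_left (ρ : ℝ) {n : ℕ} (r' : Fin n → ℤˣ) :
    ∑ r, seqProb ρ r r' = (1 / 2) ^ n := by
  unfold seqProb
  rw [sum_pi_prod (fun j a => pairProb ρ a (r' j))]
  have h : ∀ j, ∑ a, pairProb ρ a (r' j) = 1 / 2 := by
    intro j; simp only [sum_units, pairProb]; push_cast; ring
  simp_rw [h]
  simp

lemma sum_seqProb_mul_apply (ρ : ℝ) {n : ℕ} (r : Fin n → ℤˣ) (i : Fin n) :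
    ∑ r', seqProb ρ r r' * ((r' i : ℤ) : ℝ) = ρ * ((r i : ℤ) : ℝ) * (1 / 2) ^ n := by
  unfold seqProb
  rw [sum_pi_prod_mul (w := fun j b => pairProb ρ (r j) b) (fun b => ((b : ℤ) : ℝ)) i]
  have h : ∀ j, ∑ b, pairProb ρ (r j) b = 1 / 2 := by
    intro j; simp only [sum_units, pairProb]; push_cast; ring
  have h' : ∑ b, pairProb ρ (r i) b * ((b : ℤ) : ℝ) = ρ * ((r i : ℤ) : ℝ) * (1 / 2) := by
    simp only [sum_units, pairProb]; push_cast; ring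
  simp_rw [h, h']
  rw [mul_assoc, Finset.mul_prod_erase Finset.univ (fun _ => (1 / 2 : ℝ)) (Finset.mem_univ i)]
  simp

/-- The step signs by which Alice encodes her input: `1` for a one, `-1` for a zero. -/
def inputSign {n : ℕ} (x : Fin n → Bool) (j : Fin n) : ℤˣ := if x j then 1 else -1

/-- The sum of Bob's random bits over the support of `y`. -/
def partialWalk {n : ℕ} (y : Fin n → Bool) (r' : Fin n → ℤˣ) : ℝ :=
  ∑ j, ((y j).toNat : ℝ) * ((r' j : ℤ) : ℝ)

/-- The contribution of one block to Bob's test statistic. -/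
def blockStat {n : ℕ} (x y : Fin n → Bool) (p : (Fin n → ℤˣ) × (Fin n → ℤˣ)) : ℝ :=
  sgn (walk (inputSign x * p.1)) * partialWalk y p.2

/-- The Hamming weight. -/
def weight {n : ℕ} (y : Fin n → Bool) : ℝ := ∑ j, ((y j).toNat : ℝ)

/-- The mean of `blockStat x y`. -/
def blockMean {n : ℕ} (ρ : ℝ) (x y : Fin n → Bool) : ℝ :=
  ρ * meanSign n * (2 * innerProd x y - weight y)

lemma sum_seqProb_mul_blockStat {n : ℕ} (hn : 0 < n) (ρ : ℝ) (x y : Fin n → Bool) :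
    ∑ p : (Fin n → ℤˣ) × (Fin n → ℤˣ), seqProb ρ p.1 p.2 * blockStat x y p
      = blockMean ρ x y := by
  rw [Fintype.sum_prod_type]
  have h : ∀ r : Fin n → ℤˣ, ∑ r', seqProb ρ r r' * blockStat x y (r, r')
      = ∑ j, ((y j).toNat : ℝ) * ρ * (1 / 2) ^ n *
          (sgn (walk (inputSign x * r)) * ((r j : ℤ) : ℝ)) := by
    intro r
    simp only [blockStat, partialWalk, Finset.mul_sum]
    rw [Finset.sum_comm]
    refine Finset.sum_congr rfl fun j _ => ?_
    have e : ∀ r', seqProb ρ r r' *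
        (sgn (walk (inputSign x * r)) * (((y j).toNat : ℝ) * ((r' j : ℤ) : ℝ)))
        = (sgn (walk (inputSign x * r)) * ((y j).toNat : ℝ)) *
          (seqProb ρ r r' * ((r' j : ℤ) : ℝ)) := fun r' => by ring
    simp_rw [e]
    rw [← Finset.mul_sum, sum_seqProb_mul_apply]
    ring
  simp_rw [h]
  rw [Finset.sum_comm]
  simp_rw [← Finset.mul_sum, sum_sgn_walk_mul hn]
  unfold blockMean innerProd weight
  push_cast
  rw [Finset.mul_sum, ← Finset.sum_sub_distrib, Finset.mul_sum]
  refine Finset.sum_congr rfl fun j _ => ?_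
  have h2 : ((1 / 2 : ℝ) ^ n) * 2 ^ n = 1 := by rw [← mul_pow]; norm_num
  have hx : ((inputSign x j : ℤ) : ℝ) = 2 * ((x j).toNat : ℝ) - 1 := by
    unfold inputSign; cases x j <;> norm_num
  rw [hx]
  linear_combination (((y j).toNat : ℝ) * ρ * (2 * ((x j).toNat : ℝ) - 1) * meanSign n) * h2

lemma sum_partialWalk_sq_le {n : ℕ} (y : Fin n → Bool) :
    ∑ r' : Fin n → ℤˣ, (1 / 2 : ℝ) ^ n * partialWalk y r' ^ 2 ≤ n := by
  have h := sum_prod_mul_sq_sum (w := fun _ : ℤˣ => (1 / 2 : ℝ)) (by simp)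
    (fun j b => ((y j).toNat : ℝ) * ((b : ℤ) : ℝ)) (by intro j; simp)
  simp only [Finset.prod_const, Finset.card_univ, Fintype.card_fin] at h
  unfold partialWalk
  rw [h]
  calc _ ≤ ∑ _j : Fin n, (1 : ℝ) := by
        refine Finset.sum_le_sum fun j _ => ?_
        rw [sum_units]
        cases y j <;> norm_num
    _ = n := by simp

lemma sum_seqProb_prod (ρ : ℝ) (n : ℕ) :
    ∑ p : (Fin n → ℤˣ) × (Fin n → ℤˣ), seqProb ρ p.1 p.2 = 1 := by
  rw [Fintype.sum_prod_type]; exact seqProb_sum ρ n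

/-- The variance of `blockStat x y` is at most `n`, as its second moment is that of
`partialWalk y`. -/
lemma sum_seqProb_mul_sq_le {n : ℕ} (hn : 0 < n) (ρ : ℝ) (x y : Fin n → Bool) :
    ∑ p : (Fin n → ℤˣ) × (Fin n → ℤˣ),
      seqProb ρ p.1 p.2 * (blockStat x y p - blockMean ρ x y) ^ 2 ≤ n := by
  have e : ∀ p : (Fin n → ℤˣ) × (Fin n → ℤˣ),
      seqProb ρ p.1 p.2 * (blockStat x y p - blockMean ρ x y) ^ 2
      = seqProb ρ p.1 p.2 * partialWalk y p.2 ^ 2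
        - 2 * blockMean ρ x y * (seqProb ρ p.1 p.2 * blockStat x y p)
        + blockMean ρ x y ^ 2 * seqProb ρ p.1 p.2 := by
    intro p
    have : blockStat x y p ^ 2 = partialWalk y p.2 ^ 2 := by
      unfold blockStat; rw [mul_pow, sgn_sq, one_mul]
    linear_combination seqProb ρ p.1 p.2 * this
  simp_rw [e]
  rw [Finset.sum_add_distrib, Finset.sum_sub_distrib, ← Finset.mul_sum, ← Finset.mul_sum,
    sum_seqProb_mul_blockStat hn, sum_seqProb_prod]
  have h : ∑ p : (Fin n → ℤˣ) × (Fin n → ℤˣ), seqProb ρ p.1 p.2 * partialWalk y p.2 ^ 2 ≤ n := by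
    rw [Fintype.sum_prod_type_right]
    simp_rw [← Finset.sum_mul, sum_seqProb_left]
    exact sum_partialWalk_sq_le y
  nlinarith [sq_nonneg (blockMean ρ x y)]

/-! ### Independent blocks -/

/-- Cutting a sequence of `k * n` bits into `k` blocks of length `n`. -/
def blocks (k n : ℕ) : (Fin (k * n) → ℤˣ) ≃ (Fin k → Fin n → ℤˣ) :=
  (finProdFinEquiv.symm.arrowCongr (Equiv.refl ℤˣ)).trans (Equiv.curry (Fin k) (Fin n) ℤˣ)

lemma seqProb_eq_prod_blocks (ρ : ℝ) {k n : ℕ} (r r' : Fin (k * n) → ℤˣ) :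
    seqProb ρ r r' = ∏ t, seqProb ρ (blocks k n r t) (blocks k n r' t) := by
  unfold seqProb
  rw [← Fintype.prod_prod_type', ← finProdFinEquiv.prod_comp]
  rfl

lemma expectation_blocks (ρ : ℝ) {k n : ℕ}
    (F : (Fin k → (Fin n → ℤˣ) × (Fin n → ℤˣ)) → ℝ) :
    expectation ρ (fun r r' : Fin (k * n) → ℤˣ => F fun t => (blocks k n r t, blocks k n r' t))
      = ∑ ω : Fin k → (Fin n → ℤˣ) × (Fin n → ℤˣ),
          (∏ t, seqProb ρ (ω t).1 (ω t).2) * F ω := by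
  unfold expectation
  rw [← Fintype.sum_prod_type']
  refine Fintype.sum_equiv (((blocks k n).prodCongr (blocks k n)).trans
    (Equiv.arrowProdEquivProdArrow (Fin k) (fun _ => Fin n → ℤˣ) (fun _ => Fin n → ℤˣ)).symm)
    _ _ fun p => ?_
  rw [seqProb_eq_prod_blocks]
  rfl

lemma expectation_mono {ρ : ℝ} (h0 : 0 ≤ ρ) (h1 : ρ ≤ 1) {N : ℕ}
    {f g : (Fin N → ℤˣ) → (Fin N → ℤˣ) → ℝ} (h : ∀ r r', f r r' ≤ g r r') :
    expectation ρ f ≤ expectation ρ g :=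
  Finset.sum_le_sum fun r _ => Finset.sum_le_sum fun r' _ =>
    mul_le_mul_of_nonneg_left (h r r') (seqProb_nonneg h0 h1 r r')

lemma expectation_const (ρ : ℝ) {N : ℕ} (a : ℝ) :
    expectation ρ (fun _ _ : Fin N → ℤˣ => a) = a := by
  unfold expectation
  simp_rw [← Finset.sum_mul]
  rw [seqProb_sum, one_mul]

/-- Bob's test statistic, as a function of the random bits of both parties. -/
def stat {k n : ℕ} (x y : Fin n → Bool) (r r' : Fin (k * n) → ℤˣ) : ℝ :=
  ∑ t, blockStat x y (blocks k n r t, blocks k n r' t)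

lemma expectation_stat_sub_sq_le {n : ℕ} (hn : 0 < n) (ρ : ℝ) (k : ℕ) (x y : Fin n → Bool) :
    expectation ρ (fun r r' : Fin (k * n) → ℤˣ => (stat x y r r' - k * blockMean ρ x y) ^ 2)
      ≤ k * n := by
  have hc : ∑ p : (Fin n → ℤˣ) × (Fin n → ℤˣ),
      seqProb ρ p.1 p.2 * (blockStat x y p - blockMean ρ x y) = 0 := by
    simp_rw [mul_sub]
    rw [Finset.sum_sub_distrib, sum_seqProb_mul_blockStat hn, ← Finset.sum_mul,
      sum_seqProb_prod]
    ring
  have h := sum_prod_mul_sq_sum (κ := Fin k) (sum_seqProb_prod ρ n)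
    (fun _ p => blockStat x y p - blockMean ρ x y) fun _ => hc
  have hF := expectation_blocks ρ (k := k) (n := n) fun ω =>
    (∑ t, (blockStat x y (ω t) - blockMean ρ x y)) ^ 2
  rw [h] at hF
  simp only [Finset.sum_sub_distrib, Finset.sum_const, Finset.card_univ, Fintype.card_fin,
    nsmul_eq_mul] at hF
  exact hF.le.trans (mul_le_mul_of_nonneg_left (sum_seqProb_mul_sq_le hn ρ x y) k.cast_nonneg)

/-- Chebyshev's inequality for an event `A` that contains all `(r, r')` at which the test statistic
is closer than `D` to its mean. -/
lemma two_thirds_le_expectation {n : ℕ} (hn : 0 < n) {ρ : ℝ} (h0 : 0 ≤ ρ) (h1 : ρ ≤ 1) {k : ℕ}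
    (x y : Fin n → Bool) {D : ℝ} (hD : 0 < D) (hkD : 3 * (k * n) ≤ D ^ 2)
    (A : (Fin (k * n) → ℤˣ) → (Fin (k * n) → ℤˣ) → Prop) [∀ r r', Decidable (A r r')]
    (hA : ∀ r r', ¬ A r r' → D ≤ |stat x y r r' - k * blockMean ρ x y|) :
    2 / 3 ≤ expectation ρ fun r r' => if A r r' then 1 else 0 := by
  have hle := expectation_mono h0 h1
    (f := fun _ _ : Fin (k * n) → ℤˣ => (1 : ℝ))
    (g := fun r r' => (if A r r' then 1 else 0)
      + (stat x y r r' - k * blockMean ρ x y) ^ 2 / D ^ 2) (by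
    intro r r'
    split_ifs with h
    · have : 0 ≤ (stat x y r r' - k * blockMean ρ x y) ^ 2 / D ^ 2 := by positivity
      linarith
    · rw [zero_add, le_div_iff₀ (by positivity), one_mul, ← sq_abs (stat x y r r' - _)]
      exact pow_le_pow_left₀ hD.le (hA r r' h) 2)
  rw [expectation_const] at hle
  have hadd : expectation ρ (fun r r' : Fin (k * n) → ℤˣ => (if A r r' then (1 : ℝ) else 0)
      + (stat x y r r' - k * blockMean ρ x y) ^ 2 / D ^ 2)
      = expectation ρ (fun r r' : Fin (k * n) → ℤˣ => if A r r' then (1 : ℝ) else 0)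
        + expectation ρ (fun r r' : Fin (k * n) → ℤˣ =>
            (stat x y r r' - k * blockMean ρ x y) ^ 2) / D ^ 2 := by
    simp only [expectation, Finset.sum_div, ← Finset.sum_add_distrib]
    refine Finset.sum_congr rfl fun r _ => Finset.sum_congr rfl fun r' _ => ?_
    ring
  rw [hadd] at hle
  have hv : expectation ρ (fun r r' : Fin (k * n) → ℤˣ =>
      (stat x y r r' - k * blockMean ρ x y) ^ 2) / D ^ 2 ≤ 1 / 3 := by
    rw [div_le_iff₀ (by positivity)]
    linarith [expectation_stat_sub_sq_le hn ρ k x y]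
  linarith

/-! ### The protocol -/

/-- Alice sends the sign of her random walk in each of the `k` blocks; Bob multiplies these signs
with his partial walks and compares the sum of the products with the threshold `θ y`. -/
def signProtocol (k n : ℕ) (θ : (Fin n → Bool) → ℝ) :
    OneWayProtocol (Fin n → Bool) (Fin n → Bool) where
  N := k * n
  message x r := List.ofFn fun t : Fin k => decide (0 ≤ walk (inputSign x * blocks k n r t))
  output y r' m := decide (θ y ≤ ∑ t : Fin k,
    (if m.getD t false then 1 else -1) * partialWalk y (blocks k n r' t))
  prefix_free x r x₁ r₁ h := h.eq_of_length (by simp)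

lemma signProtocol_output {k n : ℕ} (θ : (Fin n → Bool) → ℝ) (x y : Fin n → Bool)
    (r r' : Fin (k * n) → ℤˣ) :
    (signProtocol k n θ).output y r' ((signProtocol k n θ).message x r)
      = decide (θ y ≤ stat x y r r') := by
  simp only [signProtocol, stat, blockStat, sgn]
  simp

lemma signProtocol_cost (k n : ℕ) (θ : (Fin n → Bool) → ℝ) (ρ : ℝ) :
    (signProtocol k n θ).cost ρ = ENNReal.ofReal k := by
  unfold OneWayProtocol.cost
  have h : ∀ x r, ((signProtocol k n θ).message x r).length = k := by
    intro x r; simp [signProtocol]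
  simp_rw [h, expectation_const]
  exact iSup_const

/-- The threshold is `k` times the block mean for an inner product of `(c + s) / 2 * n`. -/
lemma signProtocol_solves {n k : ℕ} {c s ρ : ℝ} (hn : 0 < n) (hsc : s < c) (h0 : 0 < ρ)
    (h1 : ρ ≤ 1) (hk0 : 0 < k) (hk : 9 ≤ k * (ρ ^ 2 * (c - s) ^ 2)) :
    (signProtocol k n fun y => k * (ρ * meanSign n * ((c + s) * n - weight y))).Solves ρ
      (gapInnerProduct n c s hsc) := by
  have hn' : (0 : ℝ) < n := by exact_mod_cast hn
  have hk' : (0 : ℝ) < k := by exact_mod_cast hk0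
  have hα2 := one_le_meanSign_sq hn
  have hα : 0 < meanSign n := by
    refine (meanSign_nonneg n).lt_of_ne fun h => ?_
    rw [← h] at hα2
    norm_num at hα2
  set m : ℝ := k * (ρ * meanSign n) with hm
  have hm0 : 0 < m := by positivity
  have hε : 0 < c - s := sub_pos.mpr hsc
  have hD : 0 < m * ((c - s) * n) := by positivity
  have hkD : 3 * (k * n) ≤ (m * ((c - s) * n)) ^ 2 := by
    have e : (m * ((c - s) * n)) ^ 2 * 3
        = (k * n) * ((k * (ρ ^ 2 * (c - s) ^ 2)) * (3 * n * meanSign n ^ 2)) := by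
      rw [hm]; ring
    have h9 : (9 : ℝ) ≤ (k * (ρ ^ 2 * (c - s) ^ 2)) * (3 * n * meanSign n ^ 2) := by
      nlinarith
    have := mul_le_mul_of_nonneg_left h9 (mul_pos hk' hn').le
    linarith
  have hmean : ∀ x y : Fin n → Bool,
      k * blockMean ρ x y = m * (2 * innerProd x y - weight y) := by
    intro x y; unfold blockMean; rw [hm]; ring
  refine ⟨fun x y hxy => ?_, fun x y hxy => ?_⟩
  · have hxy' : c * n ≤ (innerProd x y : ℝ) := hxy
    refine two_thirds_le_expectation hn h0.le h1 x y hD hkD _ fun r r' hA => ?_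
    rw [signProtocol_output, decide_eq_true_eq, not_le] at hA
    rw [hmean, abs_sub_comm]
    refine le_trans ?_ (le_abs_self _)
    nlinarith [mul_le_mul_of_nonneg_left hxy' hm0.le]
  · have hxy' : (innerProd x y : ℝ) < s * n := hxy
    refine two_thirds_le_expectation hn h0.le h1 x y hD hkD _ fun r r' hA => ?_
    rw [signProtocol_output, decide_eq_false_iff_not, not_not] at hA
    rw [hmean]
    refine le_trans ?_ (le_abs_self _)
    nlinarith [mul_le_mul_of_nonneg_left hxy'.le hm0.le]

end ISR

end

theorem mainTheorem9 :
    ∃ K : ℝ, 0 < K ∧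
      ∀ (n : ℕ) (c s ρ : ℝ) (_hn : 0 < n) (_hs : 0 ≤ s) (hsc : s < c) (_hc : c ≤ 1)
        (_hρ0 : 0 < ρ) (_hρ1 : ρ ≤ 1),
        ISR.owIsrCC ρ (ISR.gapInnerProduct n c s hsc)
          ≤ ENNReal.ofReal (K / (ρ ^ 2 * (c - s) ^ 2)) := by
  refine ⟨10, by norm_num, fun n c s ρ hn hs hsc hc h0 h1 => ?_⟩
  have hε : 0 < c - s := sub_pos.mpr hsc
  have hq : 0 < ρ ^ 2 * (c - s) ^ 2 := by positivity
  have hq1 : ρ ^ 2 * (c - s) ^ 2 ≤ 1 :=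
    mul_le_one₀ (pow_le_one₀ h0.le h1) (by positivity) (pow_le_one₀ hε.le (by linarith))
  set q := ρ ^ 2 * (c - s) ^ 2
  have hk : 9 / q ≤ (⌈9 / q⌉₊ : ℝ) := Nat.le_ceil _
  have hsolves := ISR.signProtocol_solves (k := ⌈9 / q⌉₊) hn hsc h0 h1
    (Nat.ceil_pos.mpr (by positivity)) ((div_le_iff₀ hq).mp hk)
  refine iInf₂_le_of_le _ hsolves ?_
  rw [ISR.signProtocol_cost]
  refine ENNReal.ofReal_le_ofReal ?_
  -- Rounding up costs at most `1 ≤ 1 / q`.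
  have h2 : (1 : ℝ) ≤ 1 / q := by rw [le_div_iff₀ hq]; linarith
  calc (⌈9 / q⌉₊ : ℝ) ≤ 9 / q + 1 := (Nat.ceil_lt_add_one (by positivity)).le
    _ ≤ 9 / q + 1 / q := by linarith
    _ = 10 / q := by ring
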